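/- Notation. Let $\mathbb{D}=\{\zeta\in\mathbb{C}:|\zeta|<1\}$ and let $\rho(\zeta,\eta)=\tanh^{-1}\left|\frac{\zeta-\eta}{1-\overline{\eta}\zeta}\right|$ be the Poincaré distance on $\mathbb{D}$. For an embedded complex submanifold $M$ of $\mathbb{C}^d$, the Kobayashi pseudodistance $\mathsf{k}_M(z,w)$ of $z,w\in M$ is the infimum of $\sum_{i=1}^m\rho(\zeta_i,\eta_i)$ over all $m\geq 1$, all $\zeta_i,\eta_i\in\mathbb{D}$ and all holomorphic maps $f_1,\dots,f_m:\mathbb{D}\to M$ with $f_1(\zeta_1)=z$, $f_i(\eta_i)=f_{i+1}(\zeta_{i+1})$ for $1\leq i<m$, and $f_m(\eta_m)=w$. The Kobayashi pseudometric is $$\kappa_M(z,X)=\inf\{\alpha>0:\ \text{there is a holomorphic } f:\mathbb{D}\to M \text{ with } f(0)=z \text{ and } \alpha f'(0)=X\}$$ for $z\in M$ and $X$ tangent to $M$ at $z$. For $\lambda\geq 1$ and $\kappa\geq 0$, a curve $\sigma:[a,b]\to M$ is a $(\lambda,\kappa)$-almost-geodesic if 1. for all $s,t\in[a,b]$, $\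 \frac{1}{\lambda}|t-s|-\kappa\leq\mathsf{k}_M(\sigma(t),\sigma(s))\leq\lambda|t-s|+\kappa$; and 2. $\sigma$ is absolutely continuous (as a map into $\mathbb{C}^d$), so that $\sigma'(t)$ exists for almost every $t\in[a,b]$, and $\kappa_M(\sigma(t),\sigma'(t))\leq\lambda$ for almost every $t\in[a,b]$. Theorem. Let $M$ be a bounded, connected, embedded complex submanifold of $\mathbb{C}^d$. For all $z,w\in M$ and every $\kappa>0$ there exist real numbers $a<b$ and a $(1,\kappa)$-almost-geodesic $\sigma:[a,b]\to M$ such that $\sigma(a)=z$ and $\sigma(b)=w$. -/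

import Mathlib

open Set Metric MeasureTheory
open scoped ENNReal NNReal ComplexConjugate

noncomputable section

/-- The complex Euclidean space `ℂ^d` with its Euclidean norm. -/
abbrev CSpace (d : ℕ) : Type := EuclideanSpace ℂ (Fin d)

/-- `M ⊆ ℂ^d` is an embedded complex submanifold of (complex) dimension `n`: every point of `M` has
a neighbourhood in `ℂ^d` (the source of `Φ`) that is mapped biholomorphically by `Φ` onto an open
subset of `ℂ^d`, in such a way that the part of `M` in it is carried onto a slice by an
`n`-dimensional complex linear subspace `V`. The set `M` need not be closed. -/
def IsEmbeddedComplexSubmanifold {d : ℕ} (n : ℕ) (M : Set (CSpace d)) : Prop :=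
  ∀ p ∈ M, ∃ (Φ : OpenPartialHomeomorph (CSpace d) (CSpace d)) (V : Submodule ℂ (CSpace d)),
    p ∈ Φ.source ∧
    DifferentiableOn ℂ Φ Φ.source ∧
    DifferentiableOn ℂ Φ.symm Φ.target ∧
    Module.finrank ℂ V = n ∧
    Φ '' (Φ.source ∩ M) = Φ.target ∩ (V : Set (CSpace d))

/-- `f` is a holomorphic map from the open unit disc to the submanifold `M` of `ℂ^d`
(only the values of `f` on the disc matter). A map into an embedded submanifold is holomorphic
exactly when it is holomorphic as a map into `ℂ^d`. -/
def IsHolomorphicDisc {d : ℕ} (M : Set (CSpace d)) (f : ℂ → CSpace d) : Prop :=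
  DifferentiableOn ℂ f (ball 0 1) ∧ MapsTo f (ball 0 1) M

/-- The Poincaré distance `artanh |(a - b) / (1 - b̄ a)|` of the points `a`, `b` of the unit disc;
it is induced by the metric `|dζ| / (1 - |ζ|²)`. -/
def poincareDist (a b : ℂ) : ℝ :=
  Real.artanh ‖(a - b) / (1 - conj b * a)‖

/-- The Kobayashi(–Royden) pseudometric
`κ_M(z, X) = inf {α > 0 : ∃ f : 𝔻 → M holomorphic, f(0) = z, α f'(0) = X}`
for `z ∈ M` and `X` a tangent vector of `M` at `z` (the infimum is `∞` if `X` is not tangent). -/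
def kobayashiMetric {d : ℕ} (M : Set (CSpace d)) (z X : CSpace d) : ℝ≥0∞ :=
  sInf {t : ℝ≥0∞ | ∃ α : ℝ≥0, 0 < α ∧ t = α ∧
    ∃ f : ℂ → CSpace d, IsHolomorphicDisc M f ∧ f 0 = z ∧ (α : ℝ) • deriv f 0 = X}

/-- A chain of `m ≥ 1` holomorphic discs in `M` from `z` to `w`: holomorphic maps `f i : 𝔻 → M` and
points `a i`, `b i` of the disc, for `i < m`, with `f i (a i) = p i` and `f i (b i) = p (i + 1)`,
where `p 0 = z` and `p m = w` (entries with larger indices play no role). -/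
structure DiscChain {d : ℕ} (M : Set (CSpace d)) (z w : CSpace d) where
  m : ℕ
  m_pos : 0 < m
  p : ℕ → CSpace d
  f : ℕ → ℂ → CSpace d
  a : ℕ → ℂ
  b : ℕ → ℂ
  p_zero : p 0 = z
  p_last : p m = w
  holo : ∀ i < m, IsHolomorphicDisc M (f i)
  a_mem : ∀ i < m, a i ∈ ball (0 : ℂ) 1
  b_mem : ∀ i < m, b i ∈ ball (0 : ℂ) 1
  f_a : ∀ i < m, f i (a i) = p i
  f_b : ∀ i < m, f i (b i) = p (i + 1)

/-- The total Poincaré length of a chain of discs. -/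
def DiscChain.length {d : ℕ} {M : Set (CSpace d)} {z w : CSpace d} (c : DiscChain M z w) : ℝ :=
  ∑ i ∈ Finset.range c.m, poincareDist (c.a i) (c.b i)

/-- The Kobayashi (pseudo)distance `k_M(z, w)`: the infimum of the total Poincaré lengths of chains
of holomorphic discs in `M` from `z` to `w` (`∞` if there is no chain). -/
def kobayashiDist {d : ℕ} (M : Set (CSpace d)) (z w : CSpace d) : ℝ≥0∞ :=
  ⨅ c : DiscChain M z w, ENNReal.ofReal c.length

/-- `σ : [a, b] → M` is a `(lam, κ)`-almost-geodesic (for `lam ≥ 1`, `κ ≥ 0`): it is absolutely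
continuous, it satisfies `|t - s| / lam - κ ≤ k_M(σ(t), σ(s)) ≤ lam |t - s| + κ` for all `s`, `t` in
`[a, b]`, and for almost every `t` in `[a, b]` the derivative `σ'(t)` exists and
`κ_M(σ(t), σ'(t)) ≤ lam`. Only the values of `σ` on `[a, b]` matter. -/
structure IsAlmostGeodesic {d : ℕ} (M : Set (CSpace d)) (lam κ : ℝ) (a b : ℝ)
    (σ : ℝ → CSpace d) : Prop where
  mapsTo : MapsTo σ (Icc a b) M
  lower : ∀ s ∈ Icc a b, ∀ t ∈ Icc a b,
    ENNReal.ofReal (1 / lam * |t - s| - κ) ≤ kobayashiDist M (σ t) (σ s)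
  upper : ∀ s ∈ Icc a b, ∀ t ∈ Icc a b,
    kobayashiDist M (σ t) (σ s) ≤ ENNReal.ofReal (lam * |t - s| + κ)
  absCont : AbsolutelyContinuousOnInterval σ a b
  speed : ∀ᵐ t ∂(volume.restrict (Icc a b)),
    DifferentiableAt ℝ σ t ∧ kobayashiMetric M (σ t) (deriv σ t) ≤ ENNReal.ofReal lam

end

/-! Choose a chain of discs from `z` to `w` whose length `L` is below `kobayashiDist M z w + κ`. In
each disc, join the two marked points by a hyperbolic geodesic parametrized by arc length, map it
into `M`, and concatenate. The resulting curve `σ` on `[0, L]` is piecewise smooth, hence Lipschitz.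
The discs themselves are competitors in both Kobayashi infima, so `σ` has Kobayashi speed at most
one and, for `s ≤ t`, its points at `s` and `t` are at distance at most `t - s`
(`DiscChain.exists_isUnitSpeedPath`). Near-minimality of `L` gives the lower bound: a shortcut
between two points of `σ` saving more than `κ` would contradict the choice of the chain
(`IsUnitSpeedPath.isAlmostGeodesic`). Connectedness of `M` makes the distance finite, so such a
chain exists. -/

open scoped Topology

/-! ### Automorphisms and geodesics of the disc -/

/-- The automorphism `ζ ↦ (a + ζ) / (1 + conj a * ζ)` of the unit disc, which maps `0` to `a`. -/
noncomputable def discShift (a ζ : ℂ) : ℂ := (a + ζ) / (1 + conj a * ζ)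

theorem one_add_conj_mul_ne_zero {a ζ : ℂ} (ha : a ∈ ball (0 : ℂ) 1) (hζ : ζ ∈ ball (0 : ℂ) 1) :
    1 + conj a * ζ ≠ 0 := by
  rw [mem_ball_zero_iff] at ha hζ
  intro h
  have h1 : conj a * ζ = -1 := by linear_combination h
  have h2 : ‖a‖ * ‖ζ‖ = 1 := by
    have := congrArg norm h1
    simpa using this
  nlinarith [norm_nonneg a, norm_nonneg ζ]

theorem norm_add_lt_norm_one_add_conj_mul {a ζ : ℂ} (ha : ‖a‖ < 1) (hζ : ‖ζ‖ < 1) :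
    ‖a + ζ‖ < ‖1 + conj a * ζ‖ := by
  have key : ‖1 + conj a * ζ‖ ^ 2 - ‖a + ζ‖ ^ 2 = (1 - ‖a‖ ^ 2) * (1 - ‖ζ‖ ^ 2) := by
    simp only [← Complex.normSq_eq_norm_sq, Complex.normSq_apply, Complex.add_re, Complex.add_im,
      Complex.mul_re, Complex.mul_im, Complex.conj_re, Complex.conj_im, Complex.one_re,
      Complex.one_im]
    ring
  have h1 : 0 < 1 - ‖a‖ ^ 2 := by nlinarith [norm_nonneg a]
  have h2 : 0 < 1 - ‖ζ‖ ^ 2 := by nlinarith [norm_nonneg ζ]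
  exact lt_of_pow_lt_pow_left₀ 2 (norm_nonneg _) (by nlinarith [mul_pos h1 h2])

theorem discShift_mem_ball {a ζ : ℂ} (ha : a ∈ ball (0 : ℂ) 1) (hζ : ζ ∈ ball (0 : ℂ) 1) :
    discShift a ζ ∈ ball (0 : ℂ) 1 := by
  have hne := one_add_conj_mul_ne_zero ha hζ
  rw [mem_ball_zero_iff] at ha hζ ⊢
  rw [discShift, norm_div, div_lt_one (norm_pos_iff.2 hne)]
  exact norm_add_lt_norm_one_add_conj_mul ha hζ

theorem differentiableOn_discShift {a : ℂ} (ha : a ∈ ball (0 : ℂ) 1) :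
    DifferentiableOn ℂ (discShift a) (ball 0 1) := by
  intro ζ hζ
  apply DifferentiableAt.differentiableWithinAt
  unfold discShift
  exact ((differentiableAt_const _).add differentiableAt_id).div
    (by fun_prop) (one_add_conj_mul_ne_zero ha hζ)

@[simp]
theorem discShift_zero (a : ℂ) : discShift a 0 = a := by simp [discShift]

/-- At `a = tanh t` this factor equals the derivative of `tanh` at `t`, which is why the geodesic
has speed one. -/
theorem hasDerivAt_discShift_zero (a : ℂ) :
    HasDerivAt (discShift a) (1 - a * conj a) 0 := by
  have h1 : HasDerivAt (fun ζ : ℂ => a + ζ) 1 0 := (hasDerivAt_id (0 : ℂ)).const_add a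
  have h2 : HasDerivAt (fun ζ : ℂ => 1 + conj a * ζ) (conj a) 0 := by
    simpa using ((hasDerivAt_id (0 : ℂ)).const_mul (conj a)).const_add 1
  have h3 : HasDerivAt (discShift a) _ 0 := h1.div h2 (by simp)
  exact h3.congr_deriv (by simp)

theorem Real.hasDerivAt_tanh_one_sub_sq (t : ℝ) :
    HasDerivAt Real.tanh (1 - Real.tanh t ^ 2) t := by
  have h := (Real.hasDerivAt_sinh t).div (Real.hasDerivAt_cosh t) (Real.cosh_pos t).ne'
  have hc := (Real.cosh_pos t).ne'
  have hfun : (Real.sinh / Real.cosh : ℝ → ℝ) = Real.tanh := by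
    ext x
    simp [Real.tanh_eq_sinh_div_cosh]
  rw [hfun] at h
  refine h.congr_deriv ?_
  rw [Real.tanh_eq_sinh_div_cosh]
  field_simp

theorem Real.contDiff_tanh_one : ContDiff ℝ 1 Real.tanh := by
  have hfun : (fun x => Real.sinh x / Real.cosh x) = Real.tanh := by
    ext x
    rw [Real.tanh_eq_sinh_div_cosh]
  rw [← hfun]
  exact Real.contDiff_sinh.div Real.contDiff_cosh fun x => (Real.cosh_pos x).ne'

theorem ofReal_tanh_mem_ball (t : ℝ) : ((Real.tanh t : ℝ) : ℂ) ∈ ball (0 : ℂ) 1 := by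
  rw [mem_ball_zero_iff, Complex.norm_real, Real.norm_eq_abs]
  exact Real.abs_tanh_lt_one t

theorem Real.abs_tanh_eq (t : ℝ) : |Real.tanh t| = Real.tanh |t| := by
  have hnonneg : ∀ x : ℝ, 0 ≤ x → 0 ≤ Real.tanh x := fun x hx => by
    rw [Real.tanh_eq_sinh_div_cosh]
    exact div_nonneg (Real.sinh_nonneg_iff.2 hx) (Real.cosh_pos x).le
  rcases le_total 0 t with h | h
  · rw [abs_of_nonneg h, abs_of_nonneg (hnonneg t h)]
  · have := hnonneg (-t) (by linarith)
    rw [abs_of_nonpos h, Real.tanh_neg, abs_of_nonpos]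
    rw [Real.tanh_neg] at this
    linarith

theorem Real.tanh_sub_eq (s t : ℝ) :
    Real.tanh (s - t) = (Real.tanh s - Real.tanh t) / (1 - Real.tanh t * Real.tanh s) := by
  have hs := (Real.cosh_pos s).ne'
  have ht := (Real.cosh_pos t).ne'
  rw [Real.tanh_eq_sinh_div_cosh, Real.sinh_sub, Real.cosh_sub, Real.tanh_eq_sinh_div_cosh,
    Real.tanh_eq_sinh_div_cosh]
  have h1 : Real.cosh s * Real.cosh t - Real.sinh s * Real.sinh t ≠ 0 := by
    rw [← Real.cosh_sub]
    exact (Real.cosh_pos _).ne'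
  have h2 : 1 - Real.sinh t / Real.cosh t * (Real.sinh s / Real.cosh s) ≠ 0 := by
    intro h
    apply h1
    field_simp at h
    linear_combination h
  rw [div_eq_div_iff h1 h2]
  field_simp

/-- At real points the Möbius quotient is the subtraction formula for `tanh`, so `tanh` parametrizes
the diameter by arc length. -/
theorem poincareDist_tanh (s t : ℝ) :
    poincareDist (Real.tanh s : ℝ) (Real.tanh t : ℝ) = |s - t| := by
  have h : (((Real.tanh s : ℝ) : ℂ) - (Real.tanh t : ℝ)) /
      (1 - conj ((Real.tanh t : ℝ) : ℂ) * (Real.tanh s : ℝ)) = (Real.tanh (s - t) : ℝ) := by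
    rw [Complex.conj_ofReal, Real.tanh_sub_eq]
    push_cast
    rfl
  rw [poincareDist, h, Complex.norm_real, Real.norm_eq_abs, Real.abs_tanh_eq, Real.artanh_tanh]

theorem poincareDist_comm (a b : ℂ) : poincareDist a b = poincareDist b a := by
  unfold poincareDist
  congr 1
  have h : conj (1 - conj b * a) = 1 - conj a * b := by
    simp [mul_comm]
  rw [norm_div, norm_div, norm_sub_rev, ← h, Complex.norm_conj]

theorem poincareDist_nonneg (a b : ℂ) : 0 ≤ poincareDist a b :=
  Real.artanh_nonneg (norm_nonneg _)

/-- Any two points of the disc lie on a hyperbolic geodesic parametrized by arc length. -/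
theorem exists_discShift_tanh_eq {a b : ℂ} (ha : a ∈ ball (0 : ℂ) 1) (hb : b ∈ ball (0 : ℂ) 1) :
    ∃ u : ℂ, ‖u‖ = 1 ∧ discShift a (u * (Real.tanh (poincareDist a b) : ℝ)) = b := by
  have hna : -a ∈ ball (0 : ℂ) 1 := by simpa using ha
  have hw := discShift_mem_ball hna hb
  have hden := one_add_conj_mul_ne_zero hna hb
  -- Moving `a` to `0` sends `b` to `w`; the geodesic becomes the radius through `w`, and `u` is its
  -- direction.
  set w := discShift (-a) b with hw_def
  have hshift : discShift a w = b := by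
    have h2 := one_add_conj_mul_ne_zero ha hw
    rw [discShift, div_eq_iff h2]
    have hden' : 1 - conj a * b ≠ 0 := by simpa [sub_eq_add_neg] using hden
    have hw' : w * (1 - conj a * b) = b - a := by
      rw [hw_def, discShift, map_neg, neg_mul, ← sub_eq_add_neg, div_mul_cancel₀ _ hden']
      ring
    linear_combination hw'
  have hnorm : Real.tanh (poincareDist a b) = ‖w‖ := by
    rw [poincareDist_comm, poincareDist]
    have : (b - a) / (1 - conj a * b) = w := by
      rw [hw_def, discShift]
      simp only [map_neg, neg_mul]
      ring
    rw [this, Real.tanh_artanh]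
    rw [mem_ball_zero_iff] at hw
    exact ⟨by linarith [norm_nonneg w], hw⟩
  rw [hnorm]
  rcases eq_or_ne w 0 with h0 | h0
  · exact ⟨1, by simp, by rw [← hshift]; simp [h0]⟩
  · have hn : ((‖w‖ : ℝ) : ℂ) ≠ 0 := by exact_mod_cast norm_ne_zero_iff.2 h0
    refine ⟨w / (‖w‖ : ℝ), ?_, ?_⟩
    · rw [norm_div, Complex.norm_real, norm_norm, div_self (norm_ne_zero_iff.2 h0)]
    · rw [div_mul_cancel₀ _ hn, hshift]

/-! ### Chains of discs and the Kobayashi distance -/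

section Kobayashi

variable {d : ℕ} {M : Set (CSpace d)} {x y z w : CSpace d}

theorem IsHolomorphicDisc.comp {f : ℂ → CSpace d} (hf : IsHolomorphicDisc M f) {φ : ℂ → ℂ}
    (hφ : DifferentiableOn ℂ φ (ball 0 1)) (hmaps : MapsTo φ (ball 0 1) (ball 0 1)) :
    IsHolomorphicDisc M (f ∘ φ) :=
  ⟨hf.1.comp hφ hmaps, hf.2.comp hmaps⟩

/-- The chain consisting of a single disc. -/
def DiscChain.single {f : ℂ → CSpace d} (hf : IsHolomorphicDisc M f) {a b : ℂ}
    (ha : a ∈ ball (0 : ℂ) 1) (hb : b ∈ ball (0 : ℂ) 1) : DiscChain M (f a) (f b) where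
  m := 1
  m_pos := one_pos
  p i := if i = 0 then f a else f b
  f _ := f
  a _ := a
  b _ := b
  p_zero := by simp
  p_last := by simp
  holo _ _ := hf
  a_mem _ _ := ha
  b_mem _ _ := hb
  f_a i hi := by simp [Nat.lt_one_iff.1 hi]
  f_b i hi := by simp

theorem DiscChain.length_single {f : ℂ → CSpace d} (hf : IsHolomorphicDisc M f) {a b : ℂ}
    (ha : a ∈ ball (0 : ℂ) 1) (hb : b ∈ ball (0 : ℂ) 1) :
    (DiscChain.single hf ha hb).length = poincareDist a b := by
  simp [DiscChain.length, DiscChain.single]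

/-- The chain traversed backwards. -/
def DiscChain.reverse (c : DiscChain M x y) : DiscChain M y x where
  m := c.m
  m_pos := c.m_pos
  p i := c.p (c.m - i)
  f i := c.f (c.m - 1 - i)
  a i := c.b (c.m - 1 - i)
  b i := c.a (c.m - 1 - i)
  p_zero := by simpa using c.p_last
  p_last := by simpa using c.p_zero
  holo i hi := c.holo _ (by omega)
  a_mem i hi := c.b_mem _ (by omega)
  b_mem i hi := c.a_mem _ (by omega)
  f_a i hi := by
    rw [c.f_b _ (by omega)]
    congr 1
    omega
  f_b i hi := by
    rw [c.f_a _ (by omega)]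
    congr 1
    omega

theorem DiscChain.length_reverse (c : DiscChain M x y) : c.reverse.length = c.length := by
  unfold DiscChain.length DiscChain.reverse
  rw [← Finset.sum_range_reflect (fun i => poincareDist (c.a i) (c.b i))]
  exact Finset.sum_congr rfl fun i _ => poincareDist_comm _ _

/-- The concatenation of two chains. -/
def DiscChain.append (c : DiscChain M x y) (c' : DiscChain M y z) : DiscChain M x z where
  m := c.m + c'.m
  m_pos := Nat.add_pos_left c.m_pos _
  p i := if i < c.m then c.p i else c'.p (i - c.m)
  f i := if i < c.m then c.f i else c'.f (i - c.m)
  a i := if i < c.m then c.a i else c'.a (i - c.m)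
  b i := if i < c.m then c.b i else c'.b (i - c.m)
  p_zero := by simp [c.m_pos, c.p_zero]
  p_last := by simp [c'.p_last]
  holo i hi := by
    split_ifs with h
    · exact c.holo i h
    · exact c'.holo _ (by omega)
  a_mem i hi := by
    split_ifs with h
    · exact c.a_mem i h
    · exact c'.a_mem _ (by omega)
  b_mem i hi := by
    split_ifs with h
    · exact c.b_mem i h
    · exact c'.b_mem _ (by omega)
  f_a i hi := by
    split_ifs with h
    · exact c.f_a i h
    · exact c'.f_a _ (by omega)
  f_b i hi := by
    by_cases h : i < c.m
    · rw [if_pos h, if_pos h, c.f_b i h]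
      split_ifs with h'
      · rfl
      -- At the junction `p` already reads from the second chain; both chains have the value `y`
      -- there.
      · have h1 : i + 1 = c.m := by omega
        rw [h1, Nat.sub_self, c.p_last, c'.p_zero]
    · rw [if_neg h, if_neg h, if_neg (by omega), c'.f_b _ (by omega)]
      congr 1
      omega

theorem DiscChain.length_append (c : DiscChain M x y) (c' : DiscChain M y z) :
    (c.append c').length = c.length + c'.length := by
  unfold DiscChain.length
  change ∑ i ∈ Finset.range (c.m + c'.m), _ = _
  rw [Finset.sum_range_add]
  congr 1
  · refine Finset.sum_congr rfl fun i hi => ?_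
    simp [DiscChain.append, Finset.mem_range.1 hi]
  · refine Finset.sum_congr rfl fun i _ => ?_
    simp [DiscChain.append]

theorem DiscChain.length_nonneg (c : DiscChain M x y) : 0 ≤ c.length :=
  Finset.sum_nonneg fun _ _ => poincareDist_nonneg _ _

theorem kobayashiDist_comm (x y : CSpace d) : kobayashiDist M x y = kobayashiDist M y x := by
  have h : ∀ x y : CSpace d, kobayashiDist M x y ≤ kobayashiDist M y x := fun x y =>
    le_iInf fun c => (iInf_le _ c.reverse).trans_eq (by rw [c.length_reverse])
  exact le_antisymm (h x y) (h y x)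

theorem kobayashiDist_triangle (x y z : CSpace d) :
    kobayashiDist M x z ≤ kobayashiDist M x y + kobayashiDist M y z :=
  ENNReal.le_iInf_add_iInf fun c c' => (iInf_le _ (c.append c')).trans_eq <| by
    rw [c.length_append, ENNReal.ofReal_add c.length_nonneg c'.length_nonneg]

theorem IsHolomorphicDisc.kobayashiDist_le {f : ℂ → CSpace d} (hf : IsHolomorphicDisc M f)
    {a b : ℂ} (ha : a ∈ ball (0 : ℂ) 1) (hb : b ∈ ball (0 : ℂ) 1) :
    kobayashiDist M (f a) (f b) ≤ ENNReal.ofReal (poincareDist a b) :=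
  (iInf_le _ (DiscChain.single hf ha hb)).trans_eq (by rw [DiscChain.length_single])

theorem isHolomorphicDisc_const (hx : x ∈ M) : IsHolomorphicDisc M fun _ => x :=
  ⟨differentiableOn_const _, fun _ _ => hx⟩

theorem kobayashiDist_self (hx : x ∈ M) : kobayashiDist M x x = 0 := by
  have h := (isHolomorphicDisc_const hx).kobayashiDist_le
    (mem_ball_self one_pos) (mem_ball_self one_pos)
  simpa [poincareDist] using h

theorem kobayashiMetric_zero (hx : x ∈ M) (c : ℝ≥0) (hc : 0 < c) : kobayashiMetric M x 0 ≤ c :=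
  sInf_le ⟨c, hc, rfl, fun _ => x, isHolomorphicDisc_const hx, rfl, by simp⟩

/-! ### Unit-speed paths and their concatenation -/

/-- A Lipschitz curve in `M` on `[0, L]` from `z` to `w` whose Kobayashi speed is at most one
outside a finite set, and which does not increase distances. -/
structure IsUnitSpeedPath (M : Set (CSpace d)) (L : ℝ) (z w : CSpace d) (σ : ℝ → CSpace d) :
    Prop where
  nonneg : 0 ≤ L
  source : σ 0 = z
  target : σ L = w
  mapsTo : MapsTo σ (Icc 0 L) M
  lipschitz : ∃ K, LipschitzOnWith K σ (Icc 0 L)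
  dist_le : ∀ s ∈ Icc 0 L, ∀ t ∈ Icc 0 L, s ≤ t →
    kobayashiDist M (σ s) (σ t) ≤ ENNReal.ofReal (t - s)
  speed : ∃ S : Set ℝ, S.Finite ∧ ∀ t ∈ Icc 0 L, t ∉ S →
    DifferentiableAt ℝ σ t ∧ kobayashiMetric M (σ t) (deriv σ t) ≤ 1

theorem isUnitSpeedPath_const (hx : x ∈ M) {L : ℝ} (hL : 0 ≤ L) :
    IsUnitSpeedPath M L x x fun _ => x where
  nonneg := hL
  source := rfl
  target := rfl
  mapsTo _ _ := hx
  lipschitz := ⟨0, (LipschitzWith.const x).lipschitzOnWith⟩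
  dist_le _ _ _ _ _ := by simp [kobayashiDist_self hx]
  speed := ⟨∅, finite_empty, fun t _ _ =>
    ⟨differentiableAt_const _, by simpa using kobayashiMetric_zero hx 1 one_pos⟩⟩

/-- Distances on the line add up through the breakpoint `b`, so the constant does not grow. -/
theorem LipschitzOnWith.ite_Icc {E : Type*} [PseudoMetricSpace E] {f g : ℝ → E} {K : ℝ≥0}
    {a b c : ℝ} (hf : LipschitzOnWith K f (Icc a b)) (hg : LipschitzOnWith K g (Icc b c))
    (hfg : f b = g b) : LipschitzOnWith K (fun t => if t ≤ b then f t else g t) (Icc a c) := by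
  have key : ∀ s ∈ Icc a c, ∀ t ∈ Icc a c, s ≤ t →
      dist (if s ≤ b then f s else g s) (if t ≤ b then f t else g t) ≤ K * dist s t := by
    intro s hs t ht hst
    by_cases h1 : t ≤ b
    · rw [if_pos (hst.trans h1), if_pos h1]
      exact hf.dist_le_mul s ⟨hs.1, hst.trans h1⟩ t ⟨ht.1, h1⟩
    · by_cases h2 : s ≤ b
      · rw [if_pos h2, if_neg h1]
        push Not at h1
        have e1 := hf.dist_le_mul s ⟨hs.1, h2⟩ b ⟨hs.1.trans h2, le_rfl⟩
        have e2 := hg.dist_le_mul b ⟨le_rfl, h1.le.trans ht.2⟩ t ⟨h1.le, ht.2⟩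
        have e3 := dist_triangle (f s) (f b) (g t)
        rw [hfg] at e3 e1
        rw [Real.dist_eq, abs_of_nonpos (by linarith)] at e1 e2 ⊢
        linarith
      · rw [if_neg h2, if_neg h1]
        push Not at h1 h2
        exact hg.dist_le_mul s ⟨h2.le, hs.2⟩ t ⟨h1.le, ht.2⟩
  refine LipschitzOnWith.of_dist_le_mul fun s hs t ht => ?_
  rcases le_total s t with h | h
  · exact key s hs t ht h
  · rw [dist_comm, dist_comm s t]
    exact key t ht s hs h

theorem IsUnitSpeedPath.append {L₁ L₂ : ℝ} {σ₁ σ₂ : ℝ → CSpace d}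
    (h₁ : IsUnitSpeedPath M L₁ x y σ₁) (h₂ : IsUnitSpeedPath M L₂ y z σ₂) :
    IsUnitSpeedPath M (L₁ + L₂) x z (fun t => if t ≤ L₁ then σ₁ t else σ₂ (t - L₁)) := by
  have hmem : ∀ t ∈ Icc 0 (L₁ + L₂), ¬ t ≤ L₁ → t - L₁ ∈ Icc 0 L₂ := fun t ht h =>
    ⟨by linarith, by linarith [ht.2]⟩
  refine ⟨add_nonneg h₁.nonneg h₂.nonneg, ?_, ?_, ?_, ?_, ?_, ?_⟩
  · simp [h₁.nonneg, h₁.source]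
  -- If `L₂ = 0`, the right endpoint falls in the first branch, and then `y = z`.
  · by_cases h : L₁ + L₂ ≤ L₁
    · have h0 : L₂ = 0 := by linarith [h₂.nonneg]
      have h' := h₂.target
      rw [h0, h₂.source] at h'
      simp [h0, h₁.target, h']
    · simp only [if_neg h, add_sub_cancel_left, h₂.target]
  · intro t ht
    by_cases h : t ≤ L₁
    · simpa only [if_pos h] using h₁.mapsTo ⟨ht.1, h⟩
    · simpa only [if_neg h] using h₂.mapsTo (hmem t ht h)
  · obtain ⟨K₁, hK₁⟩ := h₁.lipschitz
    obtain ⟨K₂, hK₂⟩ := h₂.lipschitz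
    refine ⟨max K₁ K₂, LipschitzOnWith.ite_Icc (hK₁.weaken (le_max_left _ _))
      (LipschitzOnWith.of_dist_le_mul fun s hs t ht => ?_) ?_⟩
    · have h := (hK₂.weaken (le_max_right K₁ K₂)).dist_le_mul (s - L₁)
        ⟨by linarith [hs.1], by linarith [hs.2]⟩ (t - L₁) ⟨by linarith [ht.1], by linarith [ht.2]⟩
      simpa using h
    · simp [h₁.target, h₂.source]
  · intro s hs t ht hst
    by_cases ht1 : t ≤ L₁
    · simp only [if_pos ht1, if_pos (hst.trans ht1)]
      exact h₁.dist_le s ⟨hs.1, hst.trans ht1⟩ t ⟨ht.1, ht1⟩ hst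
    · by_cases hs1 : s ≤ L₁
      · simp only [if_pos hs1, if_neg ht1]
        have e1 := h₁.dist_le s ⟨hs.1, hs1⟩ L₁ ⟨h₁.nonneg, le_rfl⟩ hs1
        have e2 := h₂.dist_le 0 ⟨le_rfl, h₂.nonneg⟩ _ (hmem t ht ht1) (hmem t ht ht1).1
        rw [h₁.target] at e1
        rw [h₂.source] at e2
        refine (kobayashiDist_triangle _ y _).trans ((add_le_add e1 e2).trans_eq ?_)
        rw [← ENNReal.ofReal_add (by linarith) (by linarith)]
        congr 1
        ring
      · simp only [if_neg hs1, if_neg ht1]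
        refine (h₂.dist_le _ (hmem s hs hs1) _ (hmem t ht ht1) (by linarith)).trans_eq ?_
        congr 1
        ring
  · obtain ⟨S₁, hS₁, H₁⟩ := h₁.speed
    obtain ⟨S₂, hS₂, H₂⟩ := h₂.speed
    -- The curve may have a corner at `L₁`; away from it, it agrees locally with one of the two
    -- pieces.
    refine ⟨insert L₁ (S₁ ∪ (fun t => t + L₁) '' S₂), (hS₁.union (hS₂.image _)).insert _, ?_⟩
    intro t ht htS
    simp only [mem_insert_iff, mem_union, not_or] at htS
    obtain ⟨hne, hn₁, hn₂⟩ := htS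
    rcases lt_or_gt_of_ne hne with hlt | hlt
    · have hev : (fun t => if t ≤ L₁ then σ₁ t else σ₂ (t - L₁)) =ᶠ[𝓝 t] σ₁ := by
        filter_upwards [Iio_mem_nhds hlt] with r hr
        exact if_pos (le_of_lt hr)
      obtain ⟨hd, hk⟩ := H₁ t ⟨ht.1, hlt.le⟩ hn₁
      refine ⟨hd.congr_of_eventuallyEq hev, ?_⟩
      rw [hev.deriv_eq]
      simpa only [if_pos hlt.le] using hk
    · have hev : (fun t => if t ≤ L₁ then σ₁ t else σ₂ (t - L₁)) =ᶠ[𝓝 t]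
          fun t => σ₂ (t - L₁) := by
        filter_upwards [Ioi_mem_nhds hlt] with r hr
        exact if_neg (not_le.2 hr)
      obtain ⟨hd, hk⟩ := H₂ (t - L₁) (hmem t ht (not_le.2 hlt))
        fun h => hn₂ ⟨t - L₁, h, by ring⟩
      refine ⟨DifferentiableAt.congr_of_eventuallyEq ?_ hev, ?_⟩
      · exact differentiableAt_comp_sub_const.2 hd
      · rw [hev.deriv_eq, deriv_comp_sub_const]
        simpa only [if_neg (not_le.2 hlt)] using hk

/-! ### From discs and chains to unit-speed paths -/

/-- The diameter `(-1, 1)` of the disc, parametrized by hyperbolic arc length. -/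
theorem IsHolomorphicDisc.isUnitSpeedPath_tanh {f : ℂ → CSpace d} (hf : IsHolomorphicDisc M f)
    {L : ℝ} (hL : 0 ≤ L) :
    IsUnitSpeedPath M L (f 0) (f (Real.tanh L : ℝ)) (fun t => f (Real.tanh t : ℝ)) where
  nonneg := hL
  source := by simp
  target := rfl
  mapsTo t _ := hf.2 (ofReal_tanh_mem_ball t)
  lipschitz := by
    have h1 : ContDiffOn ℝ 1 f (ball 0 1) :=
      (hf.1.contDiffOn (n := 1) isOpen_ball).restrict_scalars ℝ
    have h2 : ContDiff ℝ 1 fun t : ℝ => ((Real.tanh t : ℝ) : ℂ) :=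
      Complex.ofRealCLM.contDiff.comp Real.contDiff_tanh_one
    have h3 : ContDiffOn ℝ 1 (fun t : ℝ => f (Real.tanh t : ℝ)) (Icc 0 L) :=
      h1.comp h2.contDiffOn fun t _ => ofReal_tanh_mem_ball t
    exact h3.exists_lipschitzOnWith one_ne_zero (convex_Icc _ _) isCompact_Icc
  dist_le s _ t _ hst := by
    refine (hf.kobayashiDist_le (ofReal_tanh_mem_ball s) (ofReal_tanh_mem_ball t)).trans_eq ?_
    rw [poincareDist_tanh, abs_sub_comm, abs_of_nonneg (sub_nonneg.2 hst)]
  speed := by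
    refine ⟨∅, finite_empty, fun t _ _ => ?_⟩
    set r := ((Real.tanh t : ℝ) : ℂ) with hr
    have hrmem : r ∈ ball (0 : ℂ) 1 := ofReal_tanh_mem_ball t
    have hfr : HasDerivAt f (deriv f r) r :=
      (hf.1.differentiableAt (isOpen_ball.mem_nhds hrmem)).hasDerivAt
    have hh : HasDerivAt (fun t : ℝ => ((Real.tanh t : ℝ) : ℂ)) ((1 - Real.tanh t ^ 2 : ℝ) : ℂ) t :=
      (Real.hasDerivAt_tanh_one_sub_sq t).ofReal_comp
    have hσ : HasDerivAt (fun t : ℝ => f (Real.tanh t : ℝ))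
        (((1 - Real.tanh t ^ 2 : ℝ) : ℂ) • deriv f r) t :=
      hfr.scomp t hh
    refine ⟨hσ.differentiableAt, ?_⟩
    rw [hσ.deriv]
    -- Recentring `f` at `r` gives a disc whose derivative at `0` is exactly the velocity of the
    -- curve, so `α = 1` is admissible.
    refine sInf_le ⟨1, one_pos, rfl, f ∘ discShift r,
      hf.comp (differentiableOn_discShift hrmem) fun ζ hζ => discShift_mem_ball hrmem hζ,
      by simp, ?_⟩
    have hg : HasDerivAt (f ∘ discShift r) ((1 - r * conj r) • deriv f r) 0 :=
      HasDerivAt.scomp 0 (by simpa using hfr) (hasDerivAt_discShift_zero r)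
    rw [hg.deriv, NNReal.coe_one, one_smul, hr, Complex.conj_ofReal]
    congr 1
    push_cast
    ring

/-- A rotation followed by `discShift a` carries a segment of the diameter to the geodesic from `a`
to `b`, reducing to the previous case. -/
theorem IsHolomorphicDisc.exists_isUnitSpeedPath {f : ℂ → CSpace d} (hf : IsHolomorphicDisc M f)
    {a b : ℂ} (ha : a ∈ ball (0 : ℂ) 1) (hb : b ∈ ball (0 : ℂ) 1) :
    ∃ σ, IsUnitSpeedPath M (poincareDist a b) (f a) (f b) σ := by
  obtain ⟨u, hu, hub⟩ := exists_discShift_tanh_eq ha hb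
  have hrot : MapsTo (fun ζ : ℂ => u * ζ) (ball 0 1) (ball 0 1) := fun ζ hζ => by
    simpa [hu] using hζ
  have hF := (hf.comp (differentiableOn_discShift ha) fun ζ hζ => discShift_mem_ball ha hζ).comp
    (φ := fun ζ : ℂ => u * ζ) (by fun_prop) hrot
  have h := hF.isUnitSpeedPath_tanh (poincareDist_nonneg a b)
  simp only [Function.comp_apply, hub, mul_zero, discShift_zero] at h
  exact ⟨_, h⟩

theorem DiscChain.exists_isUnitSpeedPath (c : DiscChain M x y) (hx : x ∈ M) :
    ∃ σ, IsUnitSpeedPath M c.length x y σ := by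
  have key : ∀ k ≤ c.m, ∃ σ, IsUnitSpeedPath M
      (∑ i ∈ Finset.range k, poincareDist (c.a i) (c.b i)) x (c.p k) σ := by
    intro k
    induction k with
    | zero =>
      intro _
      rw [c.p_zero, Finset.sum_range_zero]
      exact ⟨_, isUnitSpeedPath_const hx le_rfl⟩
    | succ k ih =>
      intro hk
      obtain ⟨σ₁, h₁⟩ := ih (by omega)
      obtain ⟨σ₂, h₂⟩ := (c.holo k hk).exists_isUnitSpeedPath (c.a_mem k hk) (c.b_mem k hk)
      rw [c.f_a k hk, c.f_b k hk] at h₂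
      rw [Finset.sum_range_succ]
      exact ⟨_, h₁.append h₂⟩
  have h := key c.m le_rfl
  rwa [c.p_last] at h

/-! ### Nearly minimal paths are almost-geodesics -/

theorem IsUnitSpeedPath.isAlmostGeodesic {L κ : ℝ} {σ : ℝ → CSpace d}
    (h : IsUnitSpeedPath M L z w σ) (hκ : 0 ≤ κ)
    (hL : ENNReal.ofReal L ≤ kobayashiDist M z w + ENNReal.ofReal κ) :
    IsAlmostGeodesic M 1 κ 0 L σ := by
  have lower : ∀ s ∈ Icc 0 L, ∀ t ∈ Icc 0 L, s ≤ t →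
      ENNReal.ofReal (t - s - κ) ≤ kobayashiDist M (σ s) (σ t) := by
    intro s hs t ht hst
    rcases eq_or_ne (kobayashiDist M (σ s) (σ t)) ⊤ with htop | htop
    · rw [htop]
      exact le_top
    · have e1 := h.dist_le 0 ⟨le_rfl, h.nonneg⟩ s hs hs.1
      have e2 := h.dist_le t ht L ⟨h.nonneg, le_rfl⟩ ht.2
      rw [h.source] at e1
      rw [h.target] at e2
      -- Going through `σ s` and `σ t` gives `L - κ ≤ s + X + (L - t)`, where `X` is the distance
      -- between them; `L` cancels.
      have e3 : kobayashiDist M z w ≤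
          ENNReal.ofReal (s - 0) + (kobayashiDist M (σ s) (σ t) + ENNReal.ofReal (L - t)) :=
        (kobayashiDist_triangle _ (σ s) _).trans
          (add_le_add e1 ((kobayashiDist_triangle _ (σ t) _).trans (add_le_add le_rfl e2)))
      rw [← ENNReal.ofReal_toReal htop] at e3 ⊢
      set X := (kobayashiDist M (σ s) (σ t)).toReal
      have hX : 0 ≤ X := ENNReal.toReal_nonneg
      have hs0 := hs.1
      have htL := ht.2
      have e4 := hL.trans (add_le_add e3 le_rfl)
      rw [← ENNReal.ofReal_add hX (by linarith), ← ENNReal.ofReal_add (by linarith) (by linarith),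
        ← ENNReal.ofReal_add (by linarith) hκ, ENNReal.ofReal_le_ofReal_iff (by linarith)] at e4
      exact ENNReal.ofReal_le_ofReal (by linarith)
  refine ⟨h.mapsTo, ?_, ?_, ?_, ?_⟩
  · intro s hs t ht
    rw [div_one, one_mul]
    rcases le_total s t with hst | hst
    · rw [kobayashiDist_comm, abs_of_nonneg (sub_nonneg.2 hst)]
      exact lower s hs t ht hst
    · rw [abs_sub_comm, abs_of_nonneg (sub_nonneg.2 hst)]
      exact lower t ht s hs hst
  · intro s hs t ht
    rw [one_mul]
    rcases le_total s t with hst | hst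
    · rw [kobayashiDist_comm, abs_of_nonneg (sub_nonneg.2 hst)]
      exact (h.dist_le s hs t ht hst).trans (ENNReal.ofReal_le_ofReal (by linarith))
    · rw [abs_sub_comm, abs_of_nonneg (sub_nonneg.2 hst)]
      exact (h.dist_le t ht s hs hst).trans (ENNReal.ofReal_le_ofReal (by linarith))
  · obtain ⟨K, hK⟩ := h.lipschitz
    exact LipschitzOnWith.absolutelyContinuousOnInterval (by rwa [uIcc_of_le h.nonneg])
  · obtain ⟨S, hS, H⟩ := h.speed
    rw [ae_restrict_iff' measurableSet_Icc]
    filter_upwards [hS.countable.ae_notMem volume] with t htS ht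
    rw [ENNReal.ofReal_one]
    exact H t ht htS

/-! ### Finiteness of the distance -/

/-- Nearby points of an embedded complex submanifold lie on a common holomorphic disc. -/
theorem IsEmbeddedComplexSubmanifold.eventually_nonempty_discChain {n : ℕ}
    (hM : IsEmbeddedComplexSubmanifold n M) (hx : x ∈ M) :
    ∀ᶠ y in 𝓝[M] x, Nonempty (DiscChain M x y) := by
  obtain ⟨Φ, V, hxs, -, hsymm, -, himg⟩ := hM x hx
  have hmemV : ∀ q ∈ Φ.source, q ∈ M → Φ q ∈ V := fun q hq hqM =>
    (himg.subset ⟨q, ⟨hq, hqM⟩, rfl⟩).2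
  have hback : ∀ v ∈ Φ.target, v ∈ V → Φ.symm v ∈ M := fun v hv hvV => by
    obtain ⟨q, ⟨hq, hqM⟩, rfl⟩ := himg.superset ⟨hv, hvV⟩
    rwa [Φ.left_inv hq]
  obtain ⟨r, hr, hball⟩ := Metric.isOpen_iff.1 Φ.open_target (Φ x) (Φ.map_source hxs)
  have hnear : ∀ᶠ y in 𝓝[M] x, Φ y ∈ ball (Φ x) (r / 2) :=
    ((Φ.continuousAt hxs).eventually (ball_mem_nhds _ (half_pos hr))).filter_mono
      nhdsWithin_le_nhds
  have hsource : ∀ᶠ y in 𝓝[M] x, y ∈ Φ.source :=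
    nhdsWithin_le_nhds (Φ.open_source.mem_nhds hxs)
  filter_upwards [hnear, hsource, self_mem_nhdsWithin] with y hy hys hyM
  -- The factor `2` puts `Φ y` at the interior point `ζ = 1 / 2`; the radius `r / 2` above keeps the
  -- whole disc inside the ball of radius `r`.
  let ℓ : ℂ → CSpace d := fun ζ => Φ x + (2 * ζ) • (Φ y - Φ x)
  have hℓ : MapsTo ℓ (ball 0 1) Φ.target := by
    intro ζ hζ
    apply hball
    rw [mem_ball_zero_iff] at hζ
    rw [mem_ball_iff_norm] at hy ⊢
    simp only [ℓ, add_sub_cancel_left, norm_smul, norm_mul, Complex.norm_ofNat]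
    nlinarith [norm_nonneg ζ, norm_nonneg (Φ y - Φ x)]
  have hdisc : IsHolomorphicDisc M (Φ.symm ∘ ℓ) := by
    refine ⟨hsymm.comp (by fun_prop) hℓ, fun ζ hζ => hback _ (hℓ hζ) ?_⟩
    exact V.add_mem (hmemV x hxs hx)
      (V.smul_mem _ (V.sub_mem (hmemV y hys hyM) (hmemV x hxs hx)))
  have c := DiscChain.single hdisc (a := 0) (b := 1 / 2) (by simp) (by norm_num)
  have h0 : (Φ.symm ∘ ℓ) 0 = x := by simp [ℓ, Φ.left_inv hxs]
  have h1 : (Φ.symm ∘ ℓ) (1 / 2) = y := by simp [ℓ, Φ.left_inv hys]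
  rw [h0, h1] at c
  exact ⟨c⟩

/-- Being joined by a chain is symmetric, transitive and holds for nearby points, so it holds
throughout a preconnected set. -/
theorem IsEmbeddedComplexSubmanifold.nonempty_discChain {n : ℕ}
    (hM : IsEmbeddedComplexSubmanifold n M) (hconn : IsPreconnected M) (hx : x ∈ M) (hy : y ∈ M) :
    Nonempty (DiscChain M x y) :=
  hconn.induction₂ (fun x y => Nonempty (DiscChain M x y))
    (fun _ hx => hM.eventually_nonempty_discChain hx)
    (fun _ _ _ _ _ _ ⟨c⟩ ⟨c'⟩ => ⟨c.append c'⟩) (fun _ _ _ _ ⟨c⟩ => ⟨c.reverse⟩) hx hy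

end Kobayashi

theorem mainTheorem7 {d n : ℕ} (M : Set (CSpace d))
    (hM : IsEmbeddedComplexSubmanifold n M)
    (hconn : IsConnected M) (hbdd : Bornology.IsBounded M)
    (z w : CSpace d) (hz : z ∈ M) (hw : w ∈ M) (κ : ℝ) (hκ : 0 < κ) :
    ∃ (a b : ℝ) (σ : ℝ → CSpace d),
      a < b ∧ IsAlmostGeodesic M 1 κ a b σ ∧ σ a = z ∧ σ b = w := by
  obtain ⟨c₀⟩ := hM.nonempty_discChain hconn.isPreconnected hz hw
  have hfin : kobayashiDist M z w ≠ ⊤ := ne_top_of_le_ne_top ENNReal.ofReal_ne_top (iInf_le _ c₀)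
  have hlt : kobayashiDist M z w < kobayashiDist M z w + ENNReal.ofReal κ :=
    ENNReal.lt_add_right hfin (ENNReal.ofReal_pos.2 hκ).ne'
  obtain ⟨c, hc⟩ := iInf_lt_iff.1 hlt
  obtain ⟨σ, hσ⟩ := c.exists_isUnitSpeedPath hz
  rcases c.length_nonneg.eq_or_lt with h0 | hpos
  -- A chain of length zero forces `z = w` but gives a degenerate interval; the constant curve on
  -- `[0, κ]` has `a < b`, and the slack `κ` absorbs its length.
  · have hzw : z = w := by rw [← hσ.source, ← hσ.target, ← h0]
    subst hzw
    exact ⟨0, κ, fun _ => z, hκ, (isUnitSpeedPath_const hz hκ.le).isAlmostGeodesic hκ.le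
      le_add_self, rfl, rfl⟩
  · exact ⟨0, c.length, σ, hpos, hσ.isAlmostGeodesic hκ.le hc.le, hσ.source, hσ.target⟩
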